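/- Let $n,p$ be natural numbers with $n-p-1>0$, let $M\in\mathbb{R}^{n\times p}$, and let $X$ be a random $n\times p$ matrix whose entries are independent with $X_{ij}\sim \mathrm{N}(M_{ij},1)$. Let $$\hat M_{\mathrm{EM}} = X\bigl(I_p-(n-p-1)(X^\top X)^{-1}\bigr)$$ be the Efron--Morris estimator (well defined almost surely), and let $\hat M_{C_*}=XC_*$ be the linear oracle estimator, where $$C_*=C_*(M)=(M^\top M+nI_p)^{-1}M^\top M .$$ Then the matrix quadratic risks of both estimators are finite (all entries of the matrices $(\hat M-M)^\top(\hat M-M)$ are integrable), and $$\mathrm{E}_M\bigl[(\hat M_{\mathrm{EM}}-M)^\top(\hat M_{\mathrm{EM}}-M)\bigr]\preceq \mathrm{E}_M\bigl[(\hat M_{C_*}-M)^\top(\hat M_{C_*}-M)\bigr]+2(p+1)I_p ,$$ where $\mathrm{E}_M$ is the entrywise expectation and $A\preceq B$ means that $B-A$ is positive semidefinite. This holds for every $M$. -/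

import Mathlib

open MeasureTheory ProbabilityTheory Matrix

open scoped MatrixOrder

noncomputable section

/-- The matrix quadratic loss `(Mhat - M)ᵀ (Mhat - M)`. -/
def matrixQuadraticLoss {n p : ℕ} (M Mhat : Matrix (Fin n) (Fin p) ℝ) :
    Matrix (Fin p) (Fin p) ℝ :=
  (Mhat - M)ᵀ * (Mhat - M)

/-- Entrywise expectation of a random matrix. -/
def matrixExpectation {Ω : Type*} [MeasurableSpace Ω] {p : ℕ} (P : Measure Ω)
    (Y : Ω → Matrix (Fin p) (Fin p) ℝ) : Matrix (Fin p) (Fin p) ℝ :=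
  Matrix.of fun i j => ∫ ω, Y ω i j ∂P

/-- The matrix quadratic risk of the estimator `δ` of `M` based on the observation `X`. -/
def matrixQuadraticRisk {Ω : Type*} [MeasurableSpace Ω] {n p : ℕ} (P : Measure Ω)
    (X : Ω → Matrix (Fin n) (Fin p) ℝ) (M : Matrix (Fin n) (Fin p) ℝ)
    (δ : Matrix (Fin n) (Fin p) ℝ → Matrix (Fin n) (Fin p) ℝ) : Matrix (Fin p) (Fin p) ℝ :=
  matrixExpectation P fun ω => matrixQuadraticLoss M (δ (X ω))

/-- All entries of the matrix quadratic loss of `δ` are integrable, so that the risk of `δ`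
is a genuine finite expectation. -/
def HasFiniteMatrixRisk {Ω : Type*} [MeasurableSpace Ω] {n p : ℕ} (P : Measure Ω)
    (X : Ω → Matrix (Fin n) (Fin p) ℝ) (M : Matrix (Fin n) (Fin p) ℝ)
    (δ : Matrix (Fin n) (Fin p) ℝ → Matrix (Fin n) (Fin p) ℝ) : Prop :=
  ∀ i j, Integrable (fun ω => matrixQuadraticLoss M (δ (X ω)) i j) P

/-- The Efron–Morris estimator `x (I - (n - p - 1) (xᵀ x)⁻¹)`. -/
def efronMorris {n p : ℕ} (x : Matrix (Fin n) (Fin p) ℝ) : Matrix (Fin n) (Fin p) ℝ :=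
  x * (1 - ((n : ℝ) - (p : ℝ) - 1) • (xᵀ * x)⁻¹)

/-- The linear estimator `x C`. -/
def linearEstimator {n p : ℕ} (C : Matrix (Fin p) (Fin p) ℝ) (x : Matrix (Fin n) (Fin p) ℝ) :
    Matrix (Fin n) (Fin p) ℝ :=
  x * C

/-- The oracle coefficient matrix `(Mᵀ M + n I)⁻¹ Mᵀ M`. -/
def oracleCoeff {n p : ℕ} (M : Matrix (Fin n) (Fin p) ℝ) : Matrix (Fin p) (Fin p) ℝ :=
  (Mᵀ * M + (n : ℝ) • (1 : Matrix (Fin p) (Fin p) ℝ))⁻¹ * (Mᵀ * M)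

end

/-!
Replace the inverse in the Efron–Morris estimator by the ridge inverse `(XᵀX + εI)⁻¹` and look at
the loss in a fixed direction `v`. With `d = n - p - 1`, Stein's identity bounds the risk of the
regularised estimator by `n|v|² - d² E[vᵀ(XᵀX + εI)⁻¹v]`, and Jensen's inequality for the
operator-convex map `A ↦ A⁻¹`, together with `E[XᵀX] = MᵀM + nI`, bounds this in turn by
`n|v|² - d² vᵀ(MᵀM + (n + ε)I)⁻¹v`. The same identity keeps `E[vᵀ(XᵀX + εI)⁻¹v]` bounded as
`ε → 0`, so `XᵀX` is almost surely invertible and Fatou's lemma carries the bound over to the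
Efron–Morris estimator itself. The linear oracle has risk exactly `nI - n²(MᵀM + nI)⁻¹`, so the
claim reduces to `(n² - d²)(MᵀM + nI)⁻¹ ≼ 2(p + 1)I`, which holds since `n(MᵀM + nI)⁻¹ ≼ I` and
`n² - d² ≤ 2(p + 1)n`.
-/

section Stein

open scoped NNReal

theorem hasDerivAt_gaussianPDFReal (m : ℝ) (v : ℝ≥0) (x : ℝ) :
    HasDerivAt (gaussianPDFReal m v) (-((x - m) / v) * gaussianPDFReal m v x) x := by
  have hexponent : HasDerivAt (fun y : ℝ => -(y - m) ^ 2 / (2 * v)) (-((x - m) / v)) x := by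
    refine ((((hasDerivAt_id x).sub_const m).pow 2).neg.div_const (2 * (v : ℝ))).congr_deriv ?_
    simp only [id_eq]
    ring
  exact (hexponent.exp.const_mul (√(2 * Real.pi * v))⁻¹).congr_deriv (by rw [gaussianPDFReal]; ring)

theorem integrable_gaussianReal_iff {m : ℝ} {v : ℝ≥0} (hv : v ≠ 0) {g : ℝ → ℝ} :
    Integrable g (gaussianReal m v) ↔ Integrable fun x => gaussianPDFReal m v x * g x := by
  rw [gaussianReal_of_var_ne_zero m hv, integrable_withDensity_iff (measurable_gaussianPDF m v)
    (ae_of_all _ fun _ => gaussianPDF_lt_top)]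
  simp only [toReal_gaussianPDF, mul_comm]

theorem integral_sub_mul_gaussianReal {m : ℝ} {v : ℝ≥0} {f f' : ℝ → ℝ}
    (hf : ∀ x, HasDerivAt f (f' x) x) (hf_int : Integrable f (gaussianReal m v))
    (hmf_int : Integrable (fun x => (x - m) * f x) (gaussianReal m v))
    (hf'_int : Integrable f' (gaussianReal m v)) :
    ∫ x, (x - m) * f x ∂gaussianReal m v = v * ∫ x, f' x ∂gaussianReal m v := by
  obtain rfl | hv := eq_or_ne v 0
  · simp
  rw [integrable_gaussianReal_iff hv] at hf_int hmf_int hf'_int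
  have hv' : (v : ℝ) ≠ 0 := by exact_mod_cast hv
  have hparts := integral_mul_deriv_eq_deriv_mul_of_integrable (fun x _ => hf x)
    (fun x _ => hasDerivAt_gaussianPDFReal m v x)
    ((hmf_int.const_mul (-(v : ℝ)⁻¹)).congr (ae_of_all _ fun x => by
      simp only [Pi.mul_apply]; ring))
    (hf'_int.congr (ae_of_all _ fun x => mul_comm _ _))
    (hf_int.congr (ae_of_all _ fun x => mul_comm _ _))
  simp only [integral_gaussianReal_eq_integral_smul hv, smul_eq_mul]
  calc ∫ x, gaussianPDFReal m v x * ((x - m) * f x)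
      = -v * ∫ x, f x * (-((x - m) / v) * gaussianPDFReal m v x) := by
        rw [← integral_const_mul]
        congr with x
        field_simp
    _ = v * ∫ x, gaussianPDFReal m v x * f' x := by
        rw [hparts]
        simp only [mul_comm (f' _)]
        ring

section Resampling

variable {ι : Type*} [Fintype ι] [DecidableEq ι] {α : ι → Type*} [∀ i, MeasurableSpace (α i)]
  (μ : ∀ i, Measure (α i)) [∀ i, SigmaFinite (μ i)] (i : ι) [IsProbabilityMeasure (μ i)]

theorem measurePreserving_update :
    MeasurePreserving (fun q : (∀ j, α j) × α i => Function.update q.1 i q.2)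
      ((Measure.pi μ).prod (μ i)) (Measure.pi μ) := by
  refine ⟨measurable_update', (Measure.pi_eq fun s hs => ?_).symm⟩
  have hpreimage : (fun q : (∀ j, α j) × α i => Function.update q.1 i q.2) ⁻¹' Set.univ.pi s =
      Set.univ.pi (Function.update s i Set.univ) ×ˢ s i := by
    ext ⟨x, t⟩
    simp only [Set.mem_preimage, Set.mem_univ_pi, Set.mem_prod]
    rw [Function.forall_update_iff x fun j y => y ∈ s j,
      Function.forall_update_iff s fun j S => x j ∈ S]
    simp [and_comm]
  rw [Measure.map_apply measurable_update' (.univ_pi hs), hpreimage, Measure.prod_prod,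
    Measure.pi_pi, ← Finset.prod_erase_mul _ _ (Finset.mem_univ i),
    ← Finset.prod_erase_mul (f := fun j => μ j (s j)) _ (Finset.mem_univ i),
    Function.update_self, measure_univ, mul_one]
  congr 1
  exact Finset.prod_congr rfl fun j hj => by rw [Function.update_of_ne (Finset.ne_of_mem_erase hj)]

theorem integrable_update_ae {g : (∀ j, α j) → ℝ} (hg : Integrable g (Measure.pi μ)) :
    ∀ᵐ x ∂Measure.pi μ, Integrable (fun t => g (Function.update x i t)) (μ i) :=
  ((measurePreserving_update μ i).integrable_comp_of_integrable hg).prod_right_ae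

theorem integral_integral_update {g : (∀ j, α j) → ℝ} (hg : Integrable g (Measure.pi μ)) :
    ∫ x, ∫ t, g (Function.update x i t) ∂μ i ∂Measure.pi μ = ∫ x, g x ∂Measure.pi μ := by
  have hmp := measurePreserving_update μ i
  calc ∫ x, ∫ t, g (Function.update x i t) ∂μ i ∂Measure.pi μ
      = ∫ q, g (Function.update q.1 i q.2) ∂(Measure.pi μ).prod (μ i) :=
        (integral_prod _ (hmp.integrable_comp_of_integrable hg)).symm
    _ = ∫ x, g x ∂Measure.pi μ := by
        rw [← integral_map hmp.aemeasurable (by rw [hmp.map_eq]; exact hg.aestronglyMeasurable),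
          hmp.map_eq]

end Resampling

theorem integral_sub_mul_pi_gaussianReal {ι : Type*} [Fintype ι] [DecidableEq ι] {m : ι → ℝ}
    {v : ι → ℝ≥0} {f f' : (ι → ℝ) → ℝ} (i : ι)
    (hf : ∀ x, HasDerivAt (fun t => f (Function.update x i t)) (f' x) (x i))
    (hf_int : Integrable f (Measure.pi fun j => gaussianReal (m j) (v j)))
    (hmf_int : Integrable (fun x => (x i - m i) * f x)
      (Measure.pi fun j => gaussianReal (m j) (v j)))
    (hf'_int : Integrable f' (Measure.pi fun j => gaussianReal (m j) (v j))) :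
    ∫ x, (x i - m i) * f x ∂Measure.pi (fun j => gaussianReal (m j) (v j)) =
      v i * ∫ x, f' x ∂Measure.pi fun j => gaussianReal (m j) (v j) := by
  set μ : _ → Measure ℝ := fun j => gaussianReal (m j) (v j)
  rw [← integral_integral_update μ i hmf_int, ← integral_integral_update μ i hf'_int,
    ← integral_const_mul]
  refine integral_congr_ae ?_
  filter_upwards [integrable_update_ae μ i hf_int, integrable_update_ae μ i hmf_int,
    integrable_update_ae μ i hf'_int] with x hfx hmfx hf'x
  simp only [Function.update_self] at hmfx ⊢
  exact integral_sub_mul_gaussianReal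
    (fun t => by simpa using hf (Function.update x i t)) hfx hmfx hf'x

end Stein

section MatrixCalculus

variable {𝕜 l m n : Type*} [NontriviallyNormedField 𝕜] {t : 𝕜}

theorem hasDerivAt_matrix_iff [Finite m] [Finite n] {A : 𝕜 → Matrix m n 𝕜} {A' : Matrix m n 𝕜} :
    HasDerivAt A A' t ↔ ∀ i j, HasDerivAt (fun s => A s i j) (A' i j) t := by
  have := Fintype.ofFinite m
  have := Fintype.ofFinite n
  exact hasDerivAt_pi.trans (forall_congr' fun _ => hasDerivAt_pi)

theorem hasDerivAt_matrix_transpose [Finite m] [Finite n] {A : 𝕜 → Matrix m n 𝕜}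
    {A' : Matrix m n 𝕜} (hA : HasDerivAt A A' t) : HasDerivAt (fun s => (A s)ᵀ) A'ᵀ t :=
  hasDerivAt_matrix_iff.2 fun i j => hasDerivAt_matrix_iff.1 hA j i

theorem hasDerivAt_matrix_mul [Finite l] [Fintype m] [Finite n] {A : 𝕜 → Matrix l m 𝕜}
    {B : 𝕜 → Matrix m n 𝕜} {A' : Matrix l m 𝕜} {B' : Matrix m n 𝕜}
    (hA : HasDerivAt A A' t) (hB : HasDerivAt B B' t) :
    HasDerivAt (fun s => A s * B s) (A' * B t + A t * B') t := by
  refine hasDerivAt_matrix_iff.2 fun i k => ?_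
  simp only [Matrix.mul_apply, Matrix.add_apply, ← Finset.sum_add_distrib]
  exact HasDerivAt.fun_sum fun j _ =>
    (hasDerivAt_matrix_iff.1 hA i j).mul (hasDerivAt_matrix_iff.1 hB j k)

open scoped Matrix.Norms.Operator in
theorem hasDerivAt_matrix_inv {𝕜 n : Type*} [RCLike 𝕜] [Fintype n] [DecidableEq n]
    {A : 𝕜 → Matrix n n 𝕜} {A' : Matrix n n 𝕜} {t : 𝕜} (hA : HasDerivAt A A' t)
    (hu : IsUnit (A t)) :
    HasDerivAt (fun s => (A s)⁻¹) (-((A t)⁻¹ * A' * (A t)⁻¹)) t := by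
  obtain ⟨u, hu⟩ := hu
  have hinverse := hasFDerivAt_ringInverse (𝕜 := 𝕜) u
  rw [hu] at hinverse
  simp only [nonsing_inv_eq_ringInverse]
  refine (hinverse.comp_hasDerivAt t hA).congr_deriv ?_
  rw [← hu, Ring.inverse_unit]
  simp only [_root_.neg_apply, ContinuousLinearMap.mulLeftRight_apply]

theorem mul_single_mul_apply {R k l m n : Type*} [NonUnitalSemiring R] [Fintype l] [Fintype m]
    [DecidableEq l] [DecidableEq m] (A : Matrix k l R) (B : Matrix m n R) (i : l) (j : m) (c : R)
    (a : k) (b : n) : (A * Matrix.single i j c * B) a b = A a i * c * B j b := by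
  simp [Matrix.mul_apply, Matrix.single_apply, ite_and]

end MatrixCalculus

section QuadraticForms

variable {ι κ : Type*}

theorem apply_self_le_of_le {A B : Matrix κ κ ℝ} (h : A ≤ B) (j : κ) : A j j ≤ B j j :=
  sub_nonneg.1 (Matrix.le_iff.1 h).diag_nonneg

theorem sq_apply_le_transpose_mul_self_apply [Fintype ι] (A : Matrix ι κ ℝ) (i : ι) (j : κ) :
    A i j ^ 2 ≤ (Aᵀ * A) j j := by
  rw [sq]
  exact Finset.single_le_sum (f := fun i => A i j * A i j) (fun _ _ => mul_self_nonneg _)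
    (Finset.mem_univ i)

theorem transpose_mul_self_nonneg [Fintype ι] [Finite κ] (A : Matrix ι κ ℝ) : 0 ≤ Aᵀ * A := by
  simpa using (Matrix.posSemidef_conjTranspose_mul_self A).nonneg

variable [Fintype κ]

theorem dotProduct_mulVec_le_of_le {A B : Matrix κ κ ℝ} (h : A ≤ B) (v : κ → ℝ) :
    v ⬝ᵥ A *ᵥ v ≤ v ⬝ᵥ B *ᵥ v := by
  have hnonneg := (Matrix.le_iff.1 h).dotProduct_mulVec_nonneg v
  rwa [star_trivial, sub_mulVec, dotProduct_sub, sub_nonneg] at hnonneg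

theorem le_of_dotProduct_mulVec_le {A B : Matrix κ κ ℝ} (hA : A.IsHermitian) (hB : B.IsHermitian)
    (h : ∀ v, v ⬝ᵥ A *ᵥ v ≤ v ⬝ᵥ B *ᵥ v) : A ≤ B := by
  refine Matrix.le_iff.2 (.of_dotProduct_mulVec_nonneg (hB.sub hA) fun v => ?_)
  rw [star_trivial, sub_mulVec, dotProduct_sub]
  exact sub_nonneg.2 (h v)

theorem dotProduct_transpose_mul_mulVec [Fintype ι] (A B : Matrix ι κ ℝ) (v w : κ → ℝ) :
    v ⬝ᵥ (Aᵀ * B) *ᵥ w = (A *ᵥ v) ⬝ᵥ (B *ᵥ w) := by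
  rw [← mulVec_mulVec, dotProduct_mulVec, vecMul_transpose]

theorem le_trace_of_mem_spectrum [DecidableEq κ] {A : Matrix κ κ ℝ} (hA : A.PosSemidef) {r : ℝ}
    (hr : r ∈ spectrum ℝ A) : r ≤ A.trace := by
  rw [hA.isHermitian.spectrum_real_eq_range_eigenvalues] at hr
  obtain ⟨i, rfl⟩ := hr
  rw [hA.isHermitian.trace_eq_sum_eigenvalues]
  exact Finset.single_le_sum (f := hA.isHermitian.eigenvalues)
    (fun j _ => hA.eigenvalues_nonneg j) (Finset.mem_univ i)

theorem two_mul_dotProduct_sub_le_dotProduct_inv_mulVec [DecidableEq κ] {A : Matrix κ κ ℝ}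
    (hA : A.PosDef) (v w : κ → ℝ) : 2 * (v ⬝ᵥ w) - w ⬝ᵥ A *ᵥ w ≤ v ⬝ᵥ A⁻¹ *ᵥ v := by
  set u := A⁻¹ *ᵥ v with hu
  have hAu : A *ᵥ u = v := by
    rw [hu, mulVec_mulVec, Matrix.mul_nonsing_inv _ ((Matrix.isUnit_iff_isUnit_det _).1 hA.isUnit),
      one_mulVec]
  have hsymm : u ⬝ᵥ A *ᵥ w = v ⬝ᵥ w := by
    rw [dotProduct_mulVec, ← mulVec_transpose, ← conjTranspose_eq_transpose_of_trivial,
      hA.isHermitian.eq, hAu]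
  have hnonneg := hA.posSemidef.dotProduct_mulVec_nonneg (u - w)
  simp only [star_trivial, mulVec_sub, sub_dotProduct, dotProduct_sub, hAu, hsymm,
    dotProduct_comm _ v] at hnonneg
  linarith

end QuadraticForms

section MatrixExpectation

variable {Ω : Type*} [MeasurableSpace Ω] {P : Measure Ω}

theorem integrable_transpose_mul_apply {ι κ₁ κ₂ : Type*} [Fintype ι] {A : Ω → Matrix ι κ₁ ℝ}
    {B : Ω → Matrix ι κ₂ ℝ} (hA : ∀ i j, MemLp (fun ω => A ω i j) 2 P)
    (hB : ∀ i j, MemLp (fun ω => B ω i j) 2 P) (j : κ₁) (k : κ₂) :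
    Integrable (fun ω => ((A ω)ᵀ * B ω) j k) P :=
  integrable_finsetSum _ fun i _ => (hA i j).integrable_mul (hB i k)

variable {ι κ : Type*} [Fintype ι] [Fintype κ]

theorem integrable_dotProduct_mulVec {Y : Ω → Matrix ι κ ℝ}
    (hY : ∀ i j, Integrable (fun ω => Y ω i j) P) (v : ι → ℝ) (w : κ → ℝ) :
    Integrable (fun ω => v ⬝ᵥ Y ω *ᵥ w) P :=
  integrable_finsetSum _ fun i _ =>
    (integrable_finsetSum _ fun j _ => (hY i j).mul_const (w j)).const_mul (v i)

theorem integral_dotProduct_mulVec {Y : Ω → Matrix ι κ ℝ}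
    (hY : ∀ i j, Integrable (fun ω => Y ω i j) P) (v : ι → ℝ) (w : κ → ℝ) :
    ∫ ω, v ⬝ᵥ Y ω *ᵥ w ∂P = v ⬝ᵥ (Matrix.of fun i j => ∫ ω, Y ω i j ∂P) *ᵥ w := by
  have hYw : ∀ i j, Integrable (fun ω => Y ω i j * w j) P := fun i j => (hY i j).mul_const (w j)
  simp only [dotProduct, mulVec, Matrix.of_apply]
  rw [integral_finsetSum _ fun i _ => (integrable_finsetSum _ fun j _ => hYw i j).const_mul (v i)]
  simp only [integral_const_mul, integral_mul_const, integral_finsetSum _ fun j _ => hYw _ j]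

/-- Jensen's inequality for the operator-convex map `A ↦ A⁻¹`, by integrating the affine minorant
of `A ↦ vᵀA⁻¹v` that touches it at `A = B`. -/
theorem dotProduct_inv_mulVec_le_integral [IsProbabilityMeasure P] [DecidableEq κ]
    {A : Ω → Matrix κ κ ℝ} {B : Matrix κ κ ℝ} (hA : ∀ ω, (A ω).PosDef) (hB_unit : IsUnit B)
    (hA_int : ∀ w, Integrable (fun ω => w ⬝ᵥ A ω *ᵥ w) P)
    (hB : ∀ w, ∫ ω, w ⬝ᵥ A ω *ᵥ w ∂P = w ⬝ᵥ B *ᵥ w) {v : κ → ℝ}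
    (hA_inv : Integrable (fun ω => v ⬝ᵥ (A ω)⁻¹ *ᵥ v) P) :
    v ⬝ᵥ B⁻¹ *ᵥ v ≤ ∫ ω, v ⬝ᵥ (A ω)⁻¹ *ᵥ v ∂P := by
  set w := B⁻¹ *ᵥ v with hw
  have hBw : B *ᵥ w = v := by
    rw [hw, mulVec_mulVec, Matrix.mul_nonsing_inv _ ((Matrix.isUnit_iff_isUnit_det _).1 hB_unit),
      one_mulVec]
  calc v ⬝ᵥ w = ∫ ω, (2 * (v ⬝ᵥ w) - w ⬝ᵥ A ω *ᵥ w) ∂P := by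
        rw [integral_sub (integrable_const _) (hA_int w), integral_const, probReal_univ, one_smul,
          hB, hBw, dotProduct_comm w v]
        ring
    _ ≤ ∫ ω, v ⬝ᵥ (A ω)⁻¹ *ᵥ v ∂P :=
        integral_mono ((integrable_const _).sub (hA_int w)) hA_inv fun ω =>
          two_mul_dotProduct_sub_le_dotProduct_inv_mulVec (hA ω) v w

end MatrixExpectation

section Ridge

variable {ι κ : Type*} [Fintype ι] [DecidableEq κ] {ε : ℝ}

theorem posDef_gram_add_smul_one [Finite κ] (hε : 0 < ε) (x : Matrix ι κ ℝ) :
    (xᵀ * x + ε • (1 : Matrix κ κ ℝ)).PosDef := by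
  refine Matrix.PosDef.posSemidef_add ?_ (Matrix.PosDef.one.smul hε)
  simpa using Matrix.posSemidef_conjTranspose_mul_self x

variable [Fintype κ]

/-- The regularised inverse Gram matrix `(xᵀ x + ε I)⁻¹`, which replaces `(xᵀ x)⁻¹` where
integrability or differentiability is at stake. -/
noncomputable def ridgeInv (ε : ℝ) (x : Matrix ι κ ℝ) : Matrix κ κ ℝ :=
  (xᵀ * x + ε • (1 : Matrix κ κ ℝ))⁻¹

/-- The hat matrix `x (xᵀ x + ε I)⁻¹ xᵀ` of ridge regression on the design matrix `x`. -/
noncomputable def ridgeHat (ε : ℝ) (x : Matrix ι κ ℝ) : Matrix ι ι ℝ :=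
  x * ridgeInv ε x * xᵀ

theorem posDef_ridgeInv (hε : 0 < ε) (x : Matrix ι κ ℝ) : (ridgeInv ε x).PosDef :=
  (posDef_gram_add_smul_one hε x).inv

theorem transpose_ridgeInv (ε : ℝ) (x : Matrix ι κ ℝ) : (ridgeInv ε x)ᵀ = ridgeInv ε x := by
  simp [ridgeInv, transpose_nonsing_inv]

theorem ridgeInv_mul_gram (hε : 0 < ε) (x : Matrix ι κ ℝ) :
    ridgeInv ε x * (xᵀ * x) = 1 - ε • ridgeInv ε x := by
  have hinv : ridgeInv ε x * (xᵀ * x + ε • (1 : Matrix κ κ ℝ)) = 1 :=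
    Matrix.nonsing_inv_mul _
      ((Matrix.isUnit_iff_isUnit_det _).1 (posDef_gram_add_smul_one hε x).isUnit)
  rw [Matrix.mul_add, mul_smul_comm, mul_one] at hinv
  exact eq_sub_of_add_eq hinv

theorem gram_mul_ridgeInv_eq (hε : 0 < ε) (x : Matrix ι κ ℝ) :
    (x * ridgeInv ε x)ᵀ * (x * ridgeInv ε x) =
      ridgeInv ε x - ε • (ridgeInv ε x * ridgeInv ε x) := by
  rw [transpose_mul, transpose_ridgeInv, ← Matrix.mul_assoc, Matrix.mul_assoc _ xᵀ x,
    ridgeInv_mul_gram hε, sub_mul, one_mul, smul_mul_assoc]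

theorem smul_ridgeInv_mul_self_le (hε : 0 < ε) (x : Matrix ι κ ℝ) :
    ε • (ridgeInv ε x * ridgeInv ε x) ≤ ridgeInv ε x := by
  rw [← sub_nonneg, ← gram_mul_ridgeInv_eq hε]
  exact transpose_mul_self_nonneg _

theorem gram_mul_ridgeInv_le (hε : 0 < ε) (x : Matrix ι κ ℝ) :
    (x * ridgeInv ε x)ᵀ * (x * ridgeInv ε x) ≤ ridgeInv ε x := by
  rw [gram_mul_ridgeInv_eq hε, sub_le_self_iff]
  refine smul_nonneg hε.le ?_
  simpa only [transpose_ridgeInv] using transpose_mul_self_nonneg (ridgeInv ε x)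

theorem smul_ridgeInv_le_one (hε : 0 < ε) (x : Matrix ι κ ℝ) : ε • ridgeInv ε x ≤ 1 := by
  set R := ridgeInv ε x with hR
  have hsum : 1 - ε • R = (1 - ε • R)ᵀ * (1 - ε • R) + ε • ((x * R)ᵀ * (x * R)) := by
    rw [hR, gram_mul_ridgeInv_eq hε, transpose_sub, transpose_one, transpose_smul,
      transpose_ridgeInv]
    simp only [sub_mul, mul_sub, one_mul, mul_one, smul_mul_assoc, mul_smul_comm, smul_sub]
    abel
  rw [← sub_nonneg, hsum]
  exact add_nonneg (transpose_mul_self_nonneg _) (smul_nonneg hε.le (transpose_mul_self_nonneg _))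

theorem ridgeHat_nonneg (hε : 0 < ε) (x : Matrix ι κ ℝ) : 0 ≤ ridgeHat ε x := by
  have h := (posDef_ridgeInv hε x).posSemidef.mul_mul_conjTranspose_same x
  rw [conjTranspose_eq_transpose_of_trivial] at h
  exact h.nonneg

theorem ridgeHat_mul_self (hε : 0 < ε) (x : Matrix ι κ ℝ) :
    ridgeHat ε x * ridgeHat ε x =
      ridgeHat ε x - ε • (x * ridgeInv ε x * (x * ridgeInv ε x)ᵀ) := by
  have h : ridgeHat ε x * ridgeHat ε x = x * (ridgeInv ε x * (xᵀ * x)) * (ridgeInv ε x * xᵀ) := by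
    simp only [ridgeHat, Matrix.mul_assoc]
  rw [h, ridgeInv_mul_gram hε, transpose_mul, transpose_ridgeInv]
  simp only [ridgeHat, Matrix.mul_sub, Matrix.sub_mul, Matrix.mul_smul, Matrix.smul_mul,
    Matrix.mul_one, Matrix.mul_assoc]

theorem transpose_ridgeHat (ε : ℝ) (x : Matrix ι κ ℝ) : (ridgeHat ε x)ᵀ = ridgeHat ε x := by
  simp only [ridgeHat, transpose_mul, transpose_transpose, transpose_ridgeInv, Matrix.mul_assoc]

theorem ridgeHat_le_one [DecidableEq ι] (hε : 0 < ε) (x : Matrix ι κ ℝ) : ridgeHat ε x ≤ 1 := by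
  set K := x * ridgeInv ε x with hK
  have hsum : 1 - ridgeHat ε x =
      (1 - ridgeHat ε x)ᵀ * (1 - ridgeHat ε x) + ε • (Kᵀᵀ * Kᵀ) := by
    simp only [transpose_sub, transpose_one, transpose_ridgeHat, sub_mul, mul_sub, one_mul,
      mul_one, ridgeHat_mul_self hε, transpose_transpose, ← hK]
    abel
  rw [← sub_nonneg, hsum]
  exact add_nonneg (transpose_mul_self_nonneg _) (smul_nonneg hε.le (transpose_mul_self_nonneg _))

theorem trace_ridgeHat (hε : 0 < ε) (x : Matrix ι κ ℝ) :
    (ridgeHat ε x).trace = Fintype.card κ - ε * (ridgeInv ε x).trace := by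
  rw [ridgeHat, Matrix.trace_mul_comm, ← Matrix.mul_assoc, Matrix.trace_mul_comm,
    ridgeInv_mul_gram hε, Matrix.trace_sub, Matrix.trace_one, Matrix.trace_smul, smul_eq_mul]

theorem inv_mem_spectrum_ridgeInv (hε : 0 < ε) {x : Matrix ι κ ℝ} (hx : (xᵀ * x).det = 0) :
    ε⁻¹ ∈ spectrum ℝ (ridgeInv ε x) := by
  have hfactor : algebraMap ℝ (Matrix κ κ ℝ) ε⁻¹ - ridgeInv ε x =
      ε⁻¹ • (ridgeInv ε x * (xᵀ * x)) := by
    rw [ridgeInv_mul_gram hε, smul_sub, smul_smul, inv_mul_cancel₀ hε.ne', one_smul,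
      Algebra.algebraMap_eq_smul_one]
  have : Nonempty κ := by
    by_contra hκ
    rw [not_nonempty_iff] at hκ
    simp at hx
  rw [spectrum.mem_iff, hfactor, Matrix.isUnit_iff_isUnit_det, Matrix.det_smul, Matrix.det_mul, hx]
  simp

theorem inv_le_trace_ridgeInv (hε : 0 < ε) {x : Matrix ι κ ℝ} (hx : (xᵀ * x).det = 0) :
    ε⁻¹ ≤ (ridgeInv ε x).trace :=
  le_trace_of_mem_spectrum (posDef_ridgeInv hε x).posSemidef (inv_mem_spectrum_ridgeInv hε hx)

theorem ridgeInv_apply_self_le (hε : 0 < ε) (x : Matrix ι κ ℝ) (j : κ) :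
    ridgeInv ε x j j ≤ ε⁻¹ := by
  have h := apply_self_le_of_le (smul_ridgeInv_le_one hε x) j
  rw [Matrix.smul_apply, smul_eq_mul, Matrix.one_apply_eq] at h
  rwa [← one_div, le_div_iff₀' hε]

theorem abs_mul_ridgeInv_apply_le (hε : 0 < ε) (x : Matrix ι κ ℝ) (i : ι) (j : κ) :
    |(x * ridgeInv ε x) i j| ≤ √ε⁻¹ :=
  Real.abs_le_sqrt <| calc
    (x * ridgeInv ε x) i j ^ 2 ≤ ((x * ridgeInv ε x)ᵀ * (x * ridgeInv ε x)) j j :=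
      sq_apply_le_transpose_mul_self_apply _ i j
    _ ≤ ridgeInv ε x j j := apply_self_le_of_le (gram_mul_ridgeInv_le hε x) j
    _ ≤ ε⁻¹ := ridgeInv_apply_self_le hε x j

theorem abs_ridgeInv_apply_le (hε : 0 < ε) (x : Matrix ι κ ℝ) (j k : κ) :
    |ridgeInv ε x j k| ≤ ε⁻¹ := by
  refine abs_le_of_sq_le_sq ?_ (inv_nonneg.2 hε.le)
  calc ridgeInv ε x j k ^ 2 ≤ ((ridgeInv ε x)ᵀ * ridgeInv ε x) k k :=
        sq_apply_le_transpose_mul_self_apply _ j k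
    _ = ε⁻¹ * (ε • (ridgeInv ε x * ridgeInv ε x)) k k := by
        rw [transpose_ridgeInv, Matrix.smul_apply, smul_eq_mul, inv_mul_cancel_left₀ hε.ne']
    _ ≤ ε⁻¹ * ridgeInv ε x k k := by
        gcongr
        exact apply_self_le_of_le (smul_ridgeInv_mul_self_le hε x) k
    _ ≤ ε⁻¹ ^ 2 := by
        rw [sq]
        gcongr
        exact ridgeInv_apply_self_le hε x k

theorem abs_one_sub_ridgeHat_apply_self_le (hε : 0 < ε) (x : Matrix ι κ ℝ) (i : ι) :
    |1 - ridgeHat ε x i i| ≤ 1 := by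
  classical
  have hnonneg := apply_self_le_of_le (ridgeHat_nonneg hε x) i
  have hle := apply_self_le_of_le (ridgeHat_le_one hε x) i
  rw [Matrix.zero_apply] at hnonneg
  rw [Matrix.one_apply_eq] at hle
  exact abs_le.2 ⟨by linarith, by linarith⟩

theorem tendsto_ridgeInv {α : Type*} {l : Filter α} {δ : α → ℝ} {y : α → Matrix ι κ ℝ}
    {x : Matrix ι κ ℝ} (hδ : Filter.Tendsto δ l (nhds ε)) (hy : Filter.Tendsto y l (nhds x))
    (hx : (xᵀ * x + ε • (1 : Matrix κ κ ℝ)).det ≠ 0) :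
    Filter.Tendsto (fun a => ridgeInv (δ a) (y a)) l (nhds (ridgeInv ε x)) := by
  have hgram : Filter.Tendsto (fun a => (y a)ᵀ * y a + δ a • (1 : Matrix κ κ ℝ)) l
      (nhds (xᵀ * x + ε • (1 : Matrix κ κ ℝ))) :=
    ((((by fun_prop : Continuous fun z : Matrix ι κ ℝ => zᵀ * z).tendsto x).comp hy).add
      (hδ.smul_const _))
  have hinv : ContinuousAt Inv.inv (xᵀ * x + ε • (1 : Matrix κ κ ℝ)) :=
    continuousAt_matrix_inv _ (by simpa only [Ring.inverse_eq_inv'] using continuousAt_inv₀ hx)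
  exact Filter.Tendsto.comp hinv hgram

theorem continuous_ridgeInv (hε : 0 < ε) :
    Continuous (ridgeInv ε : Matrix ι κ ℝ → Matrix κ κ ℝ) :=
  continuous_iff_continuousAt.2 fun x =>
    tendsto_ridgeInv tendsto_const_nhds Filter.tendsto_id
      (posDef_gram_add_smul_one hε x).det_pos.ne'

theorem continuous_ridgeHat (hε : 0 < ε) : Continuous (ridgeHat ε : Matrix ι κ ℝ → Matrix ι ι ℝ) :=
  (continuous_id.matrix_mul (continuous_ridgeInv hε)).matrix_mul continuous_id.matrix_transpose

/-- The transposed divergence of `x ↦ x (xᵀ x + ε I)⁻¹`: its `(j, k)` entry is the sum over `i` of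
the derivative of the `(i, k)` entry of that map with respect to the `(i, j)` entry of `x`. -/
noncomputable def ridgeDivergence (ε : ℝ) (x : Matrix ι κ ℝ) : Matrix κ κ ℝ :=
  (Fintype.card ι - (ridgeHat ε x).trace) • ridgeInv ε x -
    (x * ridgeInv ε x)ᵀ * (x * ridgeInv ε x)

theorem smul_ridgeInv_le_ridgeDivergence (hε : 0 < ε) (x : Matrix ι κ ℝ) :
    ((Fintype.card ι : ℝ) - Fintype.card κ - 1) • ridgeInv ε x ≤ ridgeDivergence ε x := by
  have hdiff : ridgeDivergence ε x -
        ((Fintype.card ι : ℝ) - Fintype.card κ - 1) • ridgeInv ε x =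
      (ε * (ridgeInv ε x).trace) • ridgeInv ε x + ε • (ridgeInv ε x * ridgeInv ε x) := by
    rw [ridgeDivergence, trace_ridgeHat hε, gram_mul_ridgeInv_eq hε]
    module
  have htrace := (posDef_ridgeInv hε x).posSemidef.trace_nonneg
  rw [← sub_nonneg, hdiff]
  refine add_nonneg (smul_nonneg (by positivity) (posDef_ridgeInv hε x).posSemidef.nonneg)
    (smul_nonneg hε.le ?_)
  simpa only [transpose_ridgeInv] using transpose_mul_self_nonneg (ridgeInv ε x)

theorem hasDerivAt_ridgeInv (hε : 0 < ε) {x : ℝ → Matrix ι κ ℝ} {x' : Matrix ι κ ℝ} {t : ℝ}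
    (hx : HasDerivAt x x' t) :
    HasDerivAt (fun s => ridgeInv ε (x s))
      (-(ridgeInv ε (x t) * (x'ᵀ * x t + (x t)ᵀ * x') * ridgeInv ε (x t))) t :=
  hasDerivAt_matrix_inv (A' := x'ᵀ * x t + (x t)ᵀ * x')
    (hasDerivAt_matrix_iff.2 fun j k => (hasDerivAt_matrix_iff.1
      (hasDerivAt_matrix_mul (hasDerivAt_matrix_transpose hx) hx) j k).add_const _)
    (posDef_gram_add_smul_one hε (x t)).isUnit

theorem hasDerivAt_mul_ridgeInv (hε : 0 < ε) {x : ℝ → Matrix ι κ ℝ} {x' : Matrix ι κ ℝ} {t : ℝ}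
    (hx : HasDerivAt x x' t) :
    HasDerivAt (fun s => x s * ridgeInv ε (x s))
      (x' * ridgeInv ε (x t) - x t * ridgeInv ε (x t) * x'ᵀ * (x t * ridgeInv ε (x t)) -
        ridgeHat ε (x t) * x' * ridgeInv ε (x t)) t := by
  convert hasDerivAt_matrix_mul hx (hasDerivAt_ridgeInv hε hx) using 1
  simp only [ridgeHat, Matrix.mul_neg, Matrix.mul_add, Matrix.add_mul, Matrix.mul_assoc]
  abel

theorem hasDerivAt_mul_ridgeInv_apply [DecidableEq ι] (hε : 0 < ε) {x : ℝ → Matrix ι κ ℝ} {t : ℝ}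
    {i : ι} {j : κ} (hx : HasDerivAt x (Matrix.single i j 1) t) (k : κ) :
    HasDerivAt (fun s => (x s * ridgeInv ε (x s)) i k)
      ((1 - ridgeHat ε (x t) i i) * ridgeInv ε (x t) j k -
        (x t * ridgeInv ε (x t)) i j * (x t * ridgeInv ε (x t)) i k) t := by
  refine (hasDerivAt_matrix_iff.1 (hasDerivAt_mul_ridgeInv hε hx) i k).congr_deriv ?_
  simp only [Matrix.sub_apply, Matrix.transpose_single, Matrix.single_mul_apply_same,
    mul_single_mul_apply]
  ring

theorem sum_deriv_mul_ridgeInv_apply (x : Matrix ι κ ℝ) (j k : κ) :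
    ∑ i, ((1 - ridgeHat ε x i i) * ridgeInv ε x j k -
      (x * ridgeInv ε x) i j * (x * ridgeInv ε x) i k) = ridgeDivergence ε x j k := by
  rw [Finset.sum_sub_distrib, ← Finset.sum_mul, Finset.sum_sub_distrib, Finset.sum_const,
    Finset.card_univ, nsmul_one]
  rfl

end Ridge

section GaussianMatrix

variable {Ω : Type*} [MeasurableSpace Ω] {P : Measure Ω} {ι κ : Type*}

theorem continuous_of_prod :
    Continuous fun y : ι × κ → ℝ => Matrix.of fun i j => y (i, j) :=
  continuous_matrix fun i j => continuous_apply (i, j)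

theorem of_update_prod [DecidableEq ι] [DecidableEq κ] (y : ι × κ → ℝ) (i : ι) (j : κ) (t : ℝ) :
    (Matrix.of fun a b => Function.update y (i, j) t (a, b)) =
      (Matrix.of fun a b => y (a, b)) + (t - y (i, j)) • Matrix.single i j 1 := by
  ext a b
  by_cases h : i = a ∧ j = b
  · obtain ⟨rfl, rfl⟩ := h
    simp
  · have hne : (a, b) ≠ (i, j) := fun hab =>
      h ⟨(Prod.mk.inj hab).1.symm, (Prod.mk.inj hab).2.symm⟩
    simp [Function.update_of_ne hne, h]

/-- The random matrix `X` has independent entries with laws `N(M i j, 1)` under `P`. -/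
structure IsGaussianMatrix (X : Ω → Matrix ι κ ℝ) (M : Matrix ι κ ℝ) (P : Measure Ω) : Prop where
  hasLaw_apply : ∀ i j, HasLaw (fun ω => X ω i j) (gaussianReal (M i j) 1) P
  iIndepFun_apply : iIndepFun (fun (a : ι × κ) ω => X ω a.1 a.2) P

namespace IsGaussianMatrix

variable {X : Ω → Matrix ι κ ℝ} {M : Matrix ι κ ℝ}

theorem isProbabilityMeasure (hX : IsGaussianMatrix X M P) : IsProbabilityMeasure P :=
  hX.iIndepFun_apply.isProbabilityMeasure

theorem memLp_apply (hX : IsGaussianMatrix X M P) (i : ι) (j : κ) :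
    MemLp (fun ω => X ω i j) 2 P :=
  ((hX.hasLaw_apply i j).map_eq ▸ memLp_id_gaussianReal 2).comp_of_map
    (hX.hasLaw_apply i j).aemeasurable

theorem memLp_sub_apply (hX : IsGaussianMatrix X M P) (i : ι) (j : κ) :
    MemLp (fun ω => (X ω - M) i j) 2 P := by
  have := hX.isProbabilityMeasure
  exact (hX.memLp_apply i j).sub (memLp_const _)

theorem integral_apply (hX : IsGaussianMatrix X M P) (i : ι) (j : κ) :
    ∫ ω, X ω i j ∂P = M i j :=
  (hX.hasLaw_apply i j).integral_eq.trans integral_id_gaussianReal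

theorem variance_apply (hX : IsGaussianMatrix X M P) (i : ι) (j : κ) :
    Var[fun ω => X ω i j; P] = 1 :=
  (hX.hasLaw_apply i j).variance_eq.trans variance_id_gaussianReal

section Moments

variable [Fintype κ]

theorem memLp_mulVec_apply (hX : IsGaussianMatrix X M P) (w : κ → ℝ) (i : ι) :
    MemLp (fun ω => (X ω *ᵥ w) i) 2 P :=
  memLp_finsetSum _ fun j _ => (hX.memLp_apply i j).mul_const (w j)

theorem memLp_mul_sub_apply (hX : IsGaussianMatrix X M P) (C : Matrix κ κ ℝ) (i : ι) (j : κ) :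
    MemLp (fun ω => (X ω * C - M) i j) 2 P := by
  have := hX.isProbabilityMeasure
  exact (hX.memLp_mulVec_apply (fun k => C k j) i).sub (memLp_const _)

theorem integral_mulVec_apply (hX : IsGaussianMatrix X M P) (w : κ → ℝ) (i : ι) :
    ∫ ω, (X ω *ᵥ w) i ∂P = (M *ᵥ w) i := by
  have := hX.isProbabilityMeasure
  simp only [mulVec, dotProduct]
  rw [integral_finsetSum _ fun j _ =>
    ((hX.memLp_apply i j).integrable one_le_two).mul_const (w j)]
  simp only [integral_mul_const, hX.integral_apply]

theorem variance_mulVec_apply (hX : IsGaussianMatrix X M P) (w : κ → ℝ) (i : ι) :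
    Var[fun ω => (X ω *ᵥ w) i; P] = w ⬝ᵥ w := by
  have hindep : Set.Pairwise (Finset.univ : Finset κ) fun j k =>
      IndepFun (fun ω => X ω i j * w j) (fun ω => X ω i k * w k) P := fun j _ k _ hjk =>
    (hX.iIndepFun_apply.indepFun (i := (i, j)) (j := (i, k)) (by simpa using hjk)).comp
      (φ := (· * w j)) (ψ := (· * w k)) (by fun_prop) (by fun_prop)
  have hsum : (fun ω => (X ω *ᵥ w) i) = ∑ j, fun ω => X ω i j * w j := by
    ext ω
    simp [mulVec, dotProduct]
  rw [hsum, IndepFun.variance_sum (fun j _ => (hX.memLp_apply i j).mul_const (w j)) hindep]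
  refine Finset.sum_congr rfl fun j _ => ?_
  rw [variance_mul_const, hX.variance_apply]
  ring

theorem integral_mulVec_apply_sub_sq (hX : IsGaussianMatrix X M P) (w : κ → ℝ) (i : ι) (b : ℝ) :
    ∫ ω, ((X ω *ᵥ w) i - b) ^ 2 ∂P = w ⬝ᵥ w + ((M *ᵥ w) i - b) ^ 2 := by
  have := hX.isProbabilityMeasure
  have hmem := hX.memLp_mulVec_apply w i
  have hvar := variance_eq_sub (hmem.sub (memLp_const b))
  simp only [Pi.pow_apply, Pi.sub_apply] at hvar
  have hmean : ∫ ω, ((X ω *ᵥ w) i - b) ∂P = (M *ᵥ w) i - b := by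
    rw [integral_sub (hmem.integrable one_le_two) (integrable_const b), hX.integral_mulVec_apply]
    simp
  have hvar' : Var[fun ω => (X ω *ᵥ w) i - b; P] = w ⬝ᵥ w := by
    rw [variance_sub_const hmem.aestronglyMeasurable, hX.variance_mulVec_apply]
  rw [← hmean, ← hvar']
  exact eq_add_of_sub_eq hvar.symm

variable [Fintype ι]

theorem integrable_mulVec_sub_dotProduct_self (hX : IsGaussianMatrix X M P) (w : κ → ℝ)
    (b : ι → ℝ) : Integrable (fun ω => (X ω *ᵥ w - b) ⬝ᵥ (X ω *ᵥ w - b)) P := by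
  have := hX.isProbabilityMeasure
  refine integrable_finsetSum _ fun i _ => ?_
  have hmem := (hX.memLp_mulVec_apply w i).sub (memLp_const (b i))
  exact hmem.integrable_mul hmem

theorem integral_mulVec_sub_dotProduct_self (hX : IsGaussianMatrix X M P) (w : κ → ℝ)
    (b : ι → ℝ) : ∫ ω, (X ω *ᵥ w - b) ⬝ᵥ (X ω *ᵥ w - b) ∂P =
      Fintype.card ι * (w ⬝ᵥ w) + (M *ᵥ w - b) ⬝ᵥ (M *ᵥ w - b) := by
  have := hX.isProbabilityMeasure
  have hdot : ∀ x : Matrix ι κ ℝ,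
      (x *ᵥ w - b) ⬝ᵥ (x *ᵥ w - b) = ∑ i, ((x *ᵥ w) i - b i) ^ 2 := fun x =>
    Finset.sum_congr rfl fun i _ => (sq _).symm
  have hint : ∀ i, Integrable (fun ω => ((X ω *ᵥ w) i - b i) ^ 2) P := fun i =>
    ((hX.memLp_mulVec_apply w i).sub (memLp_const (b i))).integrable_sq
  simp only [hdot]
  rw [integral_finsetSum _ fun i _ => hint i]
  simp only [hX.integral_mulVec_apply_sub_sq, Finset.sum_add_distrib, Finset.sum_const,
    Finset.card_univ, nsmul_eq_mul]

end Moments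

section Stein

theorem hasLaw_entries [Fintype ι] [Fintype κ] (hX : IsGaussianMatrix X M P) :
    HasLaw (fun ω (a : ι × κ) => X ω a.1 a.2)
      (Measure.pi fun a : ι × κ => gaussianReal (M a.1 a.2) 1) P :=
  hX.iIndepFun_apply.hasLaw_pi fun a => hX.hasLaw_apply a.1 a.2

theorem aestronglyMeasurable_comp [Finite ι] [Finite κ] (hX : IsGaussianMatrix X M P)
    {g : Matrix ι κ ℝ → ℝ} (hg : Continuous g) :
    AEStronglyMeasurable (fun ω => g (X ω)) P := by
  have := Fintype.ofFinite ι
  have := Fintype.ofFinite κ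
  exact (hg.comp continuous_of_prod).aestronglyMeasurable.comp_aemeasurable
    hX.hasLaw_entries.aemeasurable

theorem integral_sub_mul [Finite ι] [Finite κ] [DecidableEq ι] [DecidableEq κ]
    (hX : IsGaussianMatrix X M P) {g g' : Matrix ι κ ℝ → ℝ} {i : ι} {j : κ}
    (hg : Continuous g) (hg' : Continuous g')
    (hderiv : ∀ x, HasDerivAt (fun t : ℝ => g (x + t • Matrix.single i j 1)) (g' x) 0)
    (hg_int : Integrable (fun ω => g (X ω)) P)
    (hXg_int : Integrable (fun ω => (X ω i j - M i j) * g (X ω)) P)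
    (hg'_int : Integrable (fun ω => g' (X ω)) P) :
    ∫ ω, (X ω i j - M i j) * g (X ω) ∂P = ∫ ω, g' (X ω) ∂P := by
  have := Fintype.ofFinite ι
  have := Fintype.ofFinite κ
  have hlaw := hX.hasLaw_entries
  have hint : ∀ {f : (ι × κ → ℝ) → ℝ}, Continuous f →
      Integrable (fun ω => f fun a => X ω a.1 a.2) P →
      Integrable f (Measure.pi fun a : ι × κ => gaussianReal (M a.1 a.2) 1) := fun hf h => by
    rw [← hlaw.map_eq]
    exact (integrable_map_measure hf.aestronglyMeasurable hlaw.aemeasurable).2 h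
  have hg_cont := hg.comp (continuous_of_prod (ι := ι) (κ := κ))
  have hg'_cont := hg'.comp (continuous_of_prod (ι := ι) (κ := κ))
  have hXg_cont := ((continuous_apply (i, j)).sub (continuous_const (y := M i j))).mul hg_cont
  have hstein := integral_sub_mul_pi_gaussianReal (i, j)
    (m := fun a : ι × κ => M a.1 a.2) (v := fun _ => 1)
    (f := fun y => g (Matrix.of fun i j => y (i, j)))
    (f' := fun y => g' (Matrix.of fun i j => y (i, j)))
    (fun y => by
      simp only [of_update_prod]
      refine HasDerivAt.comp_sub_const
        (f := fun t => g ((Matrix.of fun i j => y (i, j)) + t • Matrix.single i j 1)) _ _ ?_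
      rw [sub_self]
      exact hderiv _)
    (hint hg_cont hg_int) (hint hXg_cont hXg_int) (hint hg'_cont hg'_int)
  rw [NNReal.coe_one, one_mul] at hstein
  exact (hlaw.integral_comp hXg_cont.aestronglyMeasurable).trans
    (hstein.trans (hlaw.integral_comp hg'_cont.aestronglyMeasurable).symm)

end Stein

end IsGaussianMatrix

end GaussianMatrix

section RidgeStein

variable {Ω : Type*} [MeasurableSpace Ω] {P : Measure Ω} {ι κ : Type*} [Fintype ι] [Fintype κ]
  [DecidableEq κ] {X : Ω → Matrix ι κ ℝ} {M : Matrix ι κ ℝ} {ε : ℝ}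

namespace IsGaussianMatrix

theorem memLp_mul_ridgeInv_apply (hX : IsGaussianMatrix X M P) (hε : 0 < ε) (i : ι) (j : κ) :
    MemLp (fun ω => (X ω * ridgeInv ε (X ω)) i j) 2 P := by
  have := hX.isProbabilityMeasure
  exact .of_bound (hX.aestronglyMeasurable_comp
    ((continuous_id.matrix_mul (continuous_ridgeInv hε)).matrix_elem i j)) √ε⁻¹
    (ae_of_all _ fun ω => abs_mul_ridgeInv_apply_le hε (X ω) i j)

theorem integrable_ridgeInv_apply (hX : IsGaussianMatrix X M P) (hε : 0 < ε) (j k : κ) :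
    Integrable (fun ω => ridgeInv ε (X ω) j k) P := by
  have := hX.isProbabilityMeasure
  exact .of_bound (hX.aestronglyMeasurable_comp ((continuous_ridgeInv hε).matrix_elem j k)) ε⁻¹
    (ae_of_all _ fun ω => abs_ridgeInv_apply_le hε (X ω) j k)

theorem integrable_deriv_mul_ridgeInv_apply (hX : IsGaussianMatrix X M P) (hε : 0 < ε) (i : ι)
    (j k : κ) : Integrable (fun ω => (1 - ridgeHat ε (X ω) i i) * ridgeInv ε (X ω) j k -
      (X ω * ridgeInv ε (X ω)) i j * (X ω * ridgeInv ε (X ω)) i k) P :=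
  ((hX.integrable_ridgeInv_apply hε j k).bdd_mul (c := 1)
    (hX.aestronglyMeasurable_comp
      (continuous_const.sub ((continuous_ridgeHat hε).matrix_elem i i)))
    (ae_of_all _ fun ω => abs_one_sub_ridgeHat_apply_self_le hε (X ω) i)).sub
  ((hX.memLp_mul_ridgeInv_apply hε i j).integrable_mul (hX.memLp_mul_ridgeInv_apply hε i k))

theorem integral_sub_mul_mul_ridgeInv_apply (hX : IsGaussianMatrix X M P) (hε : 0 < ε) (i : ι)
    (j k : κ) : ∫ ω, (X ω - M) i j * (X ω * ridgeInv ε (X ω)) i k ∂P =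
      ∫ ω, ((1 - ridgeHat ε (X ω) i i) * ridgeInv ε (X ω) j k -
        (X ω * ridgeInv ε (X ω)) i j * (X ω * ridgeInv ε (X ω)) i k) ∂P := by
  classical
  have := hX.isProbabilityMeasure
  have hmul : Continuous fun x : Matrix ι κ ℝ => x * ridgeInv ε x :=
    continuous_id.matrix_mul (continuous_ridgeInv hε)
  have hline : ∀ x : Matrix ι κ ℝ,
      HasDerivAt (fun t : ℝ => x + t • Matrix.single i j (1 : ℝ)) (Matrix.single i j 1) 0 :=
    fun x => hasDerivAt_matrix_iff.2 fun a b =>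
      (((hasDerivAt_id (0 : ℝ)).mul_const (Matrix.single i j (1 : ℝ) a b)).const_add
        (x a b)).congr_deriv (one_mul _)
  exact hX.integral_sub_mul
    (g' := fun x => (1 - ridgeHat ε x i i) * ridgeInv ε x j k -
      (x * ridgeInv ε x) i j * (x * ridgeInv ε x) i k)
    (hmul.matrix_elem i k)
    (((continuous_const.sub ((continuous_ridgeHat hε).matrix_elem i i)).mul
      ((continuous_ridgeInv hε).matrix_elem j k)).sub
        ((hmul.matrix_elem i j).mul (hmul.matrix_elem i k)))
    (fun x => by
      simpa only [zero_smul, add_zero] using hasDerivAt_mul_ridgeInv_apply hε (hline x) k)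
    ((hX.memLp_mul_ridgeInv_apply hε i k).integrable one_le_two)
    ((hX.memLp_sub_apply i j).integrable_mul (hX.memLp_mul_ridgeInv_apply hε i k))
    (hX.integrable_deriv_mul_ridgeInv_apply hε i j k)

theorem integrable_ridgeDivergence_apply (hX : IsGaussianMatrix X M P) (hε : 0 < ε) (j k : κ) :
    Integrable (fun ω => ridgeDivergence ε (X ω) j k) P := by
  simp only [← sum_deriv_mul_ridgeInv_apply]
  exact integrable_finsetSum _ fun i _ => hX.integrable_deriv_mul_ridgeInv_apply hε i j k

theorem integral_transpose_sub_mul_mul_ridgeInv_apply (hX : IsGaussianMatrix X M P) (hε : 0 < ε)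
    (j k : κ) : ∫ ω, ((X ω - M)ᵀ * (X ω * ridgeInv ε (X ω))) j k ∂P =
      ∫ ω, ridgeDivergence ε (X ω) j k ∂P := by
  have hint : ∀ i, Integrable (fun ω => (X ω - M) i j * (X ω * ridgeInv ε (X ω)) i k) P :=
    fun i => (hX.memLp_sub_apply i j).integrable_mul (hX.memLp_mul_ridgeInv_apply hε i k)
  simp only [← sum_deriv_mul_ridgeInv_apply, Matrix.mul_apply (M := (X _ - M)ᵀ),
    Matrix.transpose_apply]
  rw [integral_finsetSum _ fun i _ => hint i,
    integral_finsetSum _ fun i _ => hX.integrable_deriv_mul_ridgeInv_apply hε i j k]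
  exact Finset.sum_congr rfl fun i _ => hX.integral_sub_mul_mul_ridgeInv_apply hε i j k

end IsGaussianMatrix

end RidgeStein

section RidgeRisk

variable {ι κ : Type*} [Fintype ι] [Fintype κ]

/-- The loss `‖(Mhat - M) v‖²` of the estimate `Mhat` of `M` in the direction `v`. The matrix
quadratic loss is the symmetric matrix whose quadratic form is `directionalLoss M Mhat`. -/
def directionalLoss (M Mhat : Matrix ι κ ℝ) (v : κ → ℝ) : ℝ :=
  ((Mhat - M) *ᵥ v) ⬝ᵥ ((Mhat - M) *ᵥ v)

theorem directionalLoss_nonneg (M Mhat : Matrix ι κ ℝ) (v : κ → ℝ) :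
    0 ≤ directionalLoss M Mhat v :=
  Finset.sum_nonneg fun _ _ => mul_self_nonneg _

theorem integrable_directionalLoss {Ω : Type*} [MeasurableSpace Ω] {P : Measure Ω}
    {M : Matrix ι κ ℝ} {Y : Ω → Matrix ι κ ℝ}
    (hY : ∀ i j, MemLp (fun ω => (Y ω - M) i j) 2 P) (v : κ → ℝ) :
    Integrable (fun ω => directionalLoss M (Y ω) v) P := by
  simp only [directionalLoss, ← dotProduct_transpose_mul_mulVec]
  exact integrable_dotProduct_mulVec (integrable_transpose_mul_apply hY hY) v v

variable [DecidableEq κ]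

/-- The estimator `x (I - c (xᵀ x + ε I)⁻¹)`, which regularises the Efron–Morris estimator: the
latter is the case `c = n - p - 1`, `ε = 0`. -/
noncomputable def ridgeEfronMorris (c ε : ℝ) (x : Matrix ι κ ℝ) : Matrix ι κ ℝ :=
  x * (1 - c • ridgeInv ε x)

theorem ridgeEfronMorris_sub (M x : Matrix ι κ ℝ) (c ε : ℝ) :
    ridgeEfronMorris c ε x - M = (x - M) - c • (x * ridgeInv ε x) := by
  rw [ridgeEfronMorris, Matrix.mul_sub, Matrix.mul_one, Matrix.mul_smul]
  abel

theorem directionalLoss_ridgeEfronMorris (M x : Matrix ι κ ℝ) (c ε : ℝ) (v : κ → ℝ) :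
    directionalLoss M (ridgeEfronMorris c ε x) v =
      (x *ᵥ v - M *ᵥ v) ⬝ᵥ (x *ᵥ v - M *ᵥ v) -
        2 * c * (v ⬝ᵥ ((x - M)ᵀ * (x * ridgeInv ε x)) *ᵥ v) +
        c ^ 2 * (v ⬝ᵥ ((x * ridgeInv ε x)ᵀ * (x * ridgeInv ε x)) *ᵥ v) := by
  rw [directionalLoss, ridgeEfronMorris_sub, dotProduct_transpose_mul_mulVec,
    dotProduct_transpose_mul_mulVec, Matrix.sub_mulVec, Matrix.smul_mulVec, Matrix.sub_mulVec]
  simp only [sub_dotProduct, dotProduct_sub, smul_dotProduct, dotProduct_smul, smul_eq_mul,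
    dotProduct_comm (x *ᵥ v) (M *ᵥ v), dotProduct_comm ((x * ridgeInv ε x) *ᵥ v)]
  ring

namespace IsGaussianMatrix

variable {Ω : Type*} [MeasurableSpace Ω] {P : Measure Ω} {X : Ω → Matrix ι κ ℝ}
  {M : Matrix ι κ ℝ} {ε : ℝ}

theorem integrable_dotProduct_ridgeInv_mulVec (hX : IsGaussianMatrix X M P) (hε : 0 < ε)
    (v : κ → ℝ) : Integrable (fun ω => v ⬝ᵥ ridgeInv ε (X ω) *ᵥ v) P :=
  integrable_dotProduct_mulVec (hX.integrable_ridgeInv_apply hε) v v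

theorem integral_dotProduct_transpose_sub_mul_mulVec_ge (hX : IsGaussianMatrix X M P)
    (hε : 0 < ε) (v : κ → ℝ) :
    ((Fintype.card ι : ℝ) - Fintype.card κ - 1) * ∫ ω, v ⬝ᵥ ridgeInv ε (X ω) *ᵥ v ∂P ≤
      ∫ ω, v ⬝ᵥ ((X ω - M)ᵀ * (X ω * ridgeInv ε (X ω))) *ᵥ v ∂P := by
  have hcross : ∀ j k, Integrable
      (fun ω => ((X ω - M)ᵀ * (X ω * ridgeInv ε (X ω))) j k) P :=
    integrable_transpose_mul_apply hX.memLp_sub_apply (hX.memLp_mul_ridgeInv_apply hε)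
  have hstein : ∫ ω, v ⬝ᵥ ((X ω - M)ᵀ * (X ω * ridgeInv ε (X ω))) *ᵥ v ∂P =
      ∫ ω, v ⬝ᵥ ridgeDivergence ε (X ω) *ᵥ v ∂P := by
    rw [integral_dotProduct_mulVec hcross,
      integral_dotProduct_mulVec (hX.integrable_ridgeDivergence_apply hε)]
    simp only [hX.integral_transpose_sub_mul_mul_ridgeInv_apply hε]
  rw [hstein, ← integral_const_mul]
  refine integral_mono ((hX.integrable_dotProduct_ridgeInv_mulVec hε v).const_mul _)
    (integrable_dotProduct_mulVec (hX.integrable_ridgeDivergence_apply hε) v v) fun ω => ?_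
  simpa only [smul_mulVec, dotProduct_smul, smul_eq_mul] using
    dotProduct_mulVec_le_of_le (smul_ridgeInv_le_ridgeDivergence hε (X ω)) v

theorem memLp_ridgeEfronMorris_sub_apply (hX : IsGaussianMatrix X M P) (hε : 0 < ε) (c : ℝ)
    (i : ι) (j : κ) : MemLp (fun ω => (ridgeEfronMorris c ε (X ω) - M) i j) 2 P := by
  simp only [ridgeEfronMorris_sub]
  exact (hX.memLp_sub_apply i j).sub ((hX.memLp_mul_ridgeInv_apply hε i j).const_mul c)

theorem integrable_directionalLoss_ridgeEfronMorris (hX : IsGaussianMatrix X M P) (hε : 0 < ε)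
    (c : ℝ) (v : κ → ℝ) :
    Integrable (fun ω => directionalLoss M (ridgeEfronMorris c ε (X ω)) v) P :=
  integrable_directionalLoss (hX.memLp_ridgeEfronMorris_sub_apply hε c) v

theorem integral_directionalLoss_ridgeEfronMorris_le (hX : IsGaussianMatrix X M P) (hε : 0 < ε)
    {c : ℝ} (hc : 0 ≤ c) (v : κ → ℝ) :
    ∫ ω, directionalLoss M (ridgeEfronMorris c ε (X ω)) v ∂P ≤
      Fintype.card ι * (v ⬝ᵥ v) -
        c * (2 * ((Fintype.card ι : ℝ) - Fintype.card κ - 1) - c) *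
          ∫ ω, v ⬝ᵥ ridgeInv ε (X ω) *ᵥ v ∂P := by
  have hmse := hX.integrable_mulVec_sub_dotProduct_self v (M *ᵥ v)
  have hcross := (integrable_dotProduct_mulVec (integrable_transpose_mul_apply hX.memLp_sub_apply
    (hX.memLp_mul_ridgeInv_apply hε)) v v).const_mul (2 * c)
  have hgram := integrable_dotProduct_mulVec (integrable_transpose_mul_apply
    (hX.memLp_mul_ridgeInv_apply hε) (hX.memLp_mul_ridgeInv_apply hε)) v v
  have hgram_le : ∫ ω, v ⬝ᵥ ((X ω * ridgeInv ε (X ω))ᵀ * (X ω * ridgeInv ε (X ω))) *ᵥ v ∂P ≤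
      ∫ ω, v ⬝ᵥ ridgeInv ε (X ω) *ᵥ v ∂P :=
    integral_mono hgram (hX.integrable_dotProduct_ridgeInv_mulVec hε v) fun ω =>
      dotProduct_mulVec_le_of_le (gram_mul_ridgeInv_le hε (X ω)) v
  have hcross_ge := hX.integral_dotProduct_transpose_sub_mul_mulVec_ge hε v
  simp only [directionalLoss_ridgeEfronMorris]
  rw [integral_add (by exact hmse.sub hcross) (hgram.const_mul _), integral_sub hmse hcross,
    integral_const_mul, integral_const_mul, hX.integral_mulVec_sub_dotProduct_self, sub_self,
    dotProduct_zero, add_zero]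
  linarith [mul_le_mul_of_nonneg_left hcross_ge hc,
    mul_le_mul_of_nonneg_left hgram_le (sq_nonneg c)]

theorem dotProduct_ridgeInv_mulVec_le_integral (hX : IsGaussianMatrix X M P) (hε : 0 < ε)
    (v : κ → ℝ) : v ⬝ᵥ ridgeInv (Fintype.card ι + ε) M *ᵥ v ≤
      ∫ ω, v ⬝ᵥ ridgeInv ε (X ω) *ᵥ v ∂P := by
  have := hX.isProbabilityMeasure
  have hform : ∀ (δ : ℝ) (x : Matrix ι κ ℝ) (w : κ → ℝ),
      w ⬝ᵥ (xᵀ * x + δ • (1 : Matrix κ κ ℝ)) *ᵥ w =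
        (x *ᵥ w) ⬝ᵥ (x *ᵥ w) + δ * (w ⬝ᵥ w) := fun δ x w => by
    rw [add_mulVec, dotProduct_add, dotProduct_transpose_mul_mulVec, smul_mulVec, one_mulVec,
      dotProduct_smul, smul_eq_mul]
  have hgram : ∀ w, Integrable (fun ω => (X ω *ᵥ w) ⬝ᵥ (X ω *ᵥ w)) P := fun w => by
    simpa only [sub_zero] using hX.integrable_mulVec_sub_dotProduct_self w 0
  refine dotProduct_inv_mulVec_le_integral (fun ω => posDef_gram_add_smul_one hε (X ω))
    (posDef_gram_add_smul_one (by positivity) M).isUnit (fun w => ?_) (fun w => ?_)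
    (hX.integrable_dotProduct_ridgeInv_mulVec hε v)
  · simp only [hform]
    exact (hgram w).add (integrable_const _)
  · have hmean := hX.integral_mulVec_sub_dotProduct_self w 0
    simp only [sub_zero] at hmean
    simp only [hform]
    rw [integral_add (hgram w) (integrable_const _), hmean, integral_const, probReal_univ, one_smul]
    ring

end IsGaussianMatrix

end RidgeRisk

theorem integrable_and_integral_le_of_tendsto_of_le {Ω : Type*} [MeasurableSpace Ω]
    {P : Measure Ω} {F : ℕ → Ω → ℝ} {f : Ω → ℝ} {b : ℕ → ℝ} {b₀ : ℝ}
    (hF_nonneg : ∀ k ω, 0 ≤ F k ω) (hF_int : ∀ k, Integrable (F k) P)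
    (hF : ∀ᵐ ω ∂P, Filter.Tendsto (fun k => F k ω) Filter.atTop (nhds (f ω)))
    (hFb : ∀ k, ∫ ω, F k ω ∂P ≤ b k) (hb : Filter.Tendsto b Filter.atTop (nhds b₀)) :
    Integrable f P ∧ ∫ ω, f ω ∂P ≤ b₀ := by
  have hf_meas : AEStronglyMeasurable f P :=
    aestronglyMeasurable_of_tendsto_ae Filter.atTop (fun k => (hF_int k).aestronglyMeasurable) hF
  have hf_nonneg : 0 ≤ᵐ[P] f := hF.mono fun ω h => ge_of_tendsto' h fun k => hF_nonneg k ω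
  have hb_nonneg : 0 ≤ b₀ :=
    ge_of_tendsto' hb fun k => (integral_nonneg (hF_nonneg k)).trans (hFb k)
  have hfatou : ∫⁻ ω, ENNReal.ofReal (f ω) ∂P ≤ ENNReal.ofReal b₀ := calc
    ∫⁻ ω, ENNReal.ofReal (f ω) ∂P
        = ∫⁻ ω, Filter.liminf (fun k => ENNReal.ofReal (F k ω)) Filter.atTop ∂P :=
      lintegral_congr_ae (hF.mono fun ω h => ((ENNReal.tendsto_ofReal h).liminf_eq).symm)
    _ ≤ Filter.liminf (fun k => ∫⁻ ω, ENNReal.ofReal (F k ω) ∂P) Filter.atTop :=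
      lintegral_liminf_le' fun k => (hF_int k).aestronglyMeasurable.aemeasurable.ennreal_ofReal
    _ ≤ Filter.liminf (fun k => ENNReal.ofReal (b k)) Filter.atTop := by
      refine Filter.liminf_le_liminf (Filter.Eventually.of_forall fun k => ?_)
      rw [← ofReal_integral_eq_lintegral_ofReal (hF_int k) (ae_of_all _ (hF_nonneg k))]
      exact ENNReal.ofReal_le_ofReal (hFb k)
    _ = ENNReal.ofReal b₀ := (ENNReal.tendsto_ofReal hb).liminf_eq
  refine ⟨⟨hf_meas, ?_⟩, ?_⟩
  · rw [hasFiniteIntegral_iff_ofReal hf_nonneg]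
    exact hfatou.trans_lt ENNReal.ofReal_lt_top
  · rw [integral_eq_lintegral_of_nonneg_ae hf_nonneg hf_meas]
    exact ENNReal.toReal_le_of_le_ofReal hb_nonneg hfatou

section ZeroRidge

variable {Ω : Type*} [MeasurableSpace Ω] {P : Measure Ω} {ι κ : Type*} [Fintype ι] [Fintype κ]
  [DecidableEq κ] {X : Ω → Matrix ι κ ℝ} {M : Matrix ι κ ℝ} {ε : ℝ}

namespace IsGaussianMatrix

theorem sq_mul_integral_dotProduct_ridgeInv_mulVec_le (hX : IsGaussianMatrix X M P)
    (hε : 0 < ε) (hcard : Fintype.card κ + 1 ≤ Fintype.card ι) (v : κ → ℝ) :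
    ((Fintype.card ι : ℝ) - Fintype.card κ - 1) ^ 2 * ∫ ω, v ⬝ᵥ ridgeInv ε (X ω) *ᵥ v ∂P ≤
      Fintype.card ι * (v ⬝ᵥ v) := by
  have hd : (0 : ℝ) ≤ (Fintype.card ι : ℝ) - Fintype.card κ - 1 := by
    have : (Fintype.card κ : ℝ) + 1 ≤ Fintype.card ι := mod_cast hcard
    linarith
  have hrisk := hX.integral_directionalLoss_ridgeEfronMorris_le hε hd v
  have hnonneg : 0 ≤ ∫ ω, directionalLoss M
      (ridgeEfronMorris ((Fintype.card ι : ℝ) - Fintype.card κ - 1) ε (X ω)) v ∂P :=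
    integral_nonneg fun ω => directionalLoss_nonneg M _ v
  linarith

theorem sq_mul_integral_trace_ridgeInv_le (hX : IsGaussianMatrix X M P) (hε : 0 < ε)
    (hcard : Fintype.card κ + 1 ≤ Fintype.card ι) :
    ((Fintype.card ι : ℝ) - Fintype.card κ - 1) ^ 2 * ∫ ω, (ridgeInv ε (X ω)).trace ∂P ≤
      Fintype.card ι * Fintype.card κ := by
  simp only [Matrix.trace, Matrix.diag_apply]
  rw [integral_finsetSum _ fun j _ => hX.integrable_ridgeInv_apply hε j j, Finset.mul_sum]
  calc _ ≤ ∑ _j : κ, (Fintype.card ι : ℝ) := Finset.sum_le_sum fun j _ => by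
        simpa using hX.sq_mul_integral_dotProduct_ridgeInv_mulVec_le hε hcard (Pi.single j 1)
    _ = _ := by rw [Finset.sum_const, Finset.card_univ, nsmul_eq_mul, mul_comm]

/-- Inverse moments rule out singularity: the trace of `(Xᵀ X + ε I)⁻¹` is at least `ε⁻¹` wherever
`Xᵀ X` is singular, whereas its expectation is bounded uniformly in `ε`. -/
theorem sq_mul_measureReal_det_gram_eq_zero_le (hX : IsGaussianMatrix X M P) (hε : 0 < ε)
    (hcard : Fintype.card κ + 1 ≤ Fintype.card ι) :
    ((Fintype.card ι : ℝ) - Fintype.card κ - 1) ^ 2 * P.real {ω | ((X ω)ᵀ * X ω).det = 0} ≤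
      ε * (Fintype.card ι * Fintype.card κ) := by
  have := hX.isProbabilityMeasure
  have htrace_nonneg : ∀ ω, 0 ≤ (ridgeInv ε (X ω)).trace := fun ω =>
    (posDef_ridgeInv hε (X ω)).posSemidef.trace_nonneg
  have hmarkov : ε⁻¹ * P.real {ω | ((X ω)ᵀ * X ω).det = 0} ≤
      ∫ ω, (ridgeInv ε (X ω)).trace ∂P := calc
    _ ≤ ε⁻¹ * P.real {ω | ε⁻¹ ≤ (ridgeInv ε (X ω)).trace} :=
      mul_le_mul_of_nonneg_left (measureReal_mono fun ω hω => inv_le_trace_ridgeInv hε hω)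
        (inv_nonneg.2 hε.le)
    _ ≤ _ := mul_meas_ge_le_integral_of_nonneg (ae_of_all _ htrace_nonneg)
      (integrable_finsetSum _ fun j _ => hX.integrable_ridgeInv_apply hε j j) _
  rw [← inv_mul_le_iff₀ hε, mul_left_comm]
  exact (mul_le_mul_of_nonneg_left hmarkov (sq_nonneg _)).trans
    (hX.sq_mul_integral_trace_ridgeInv_le hε hcard)

theorem ae_det_gram_ne_zero (hX : IsGaussianMatrix X M P)
    (hcard : Fintype.card κ + 1 < Fintype.card ι) : ∀ᵐ ω ∂P, ((X ω)ᵀ * X ω).det ≠ 0 := by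
  have := hX.isProbabilityMeasure
  have hd : 0 < ((Fintype.card ι : ℝ) - Fintype.card κ - 1) ^ 2 := by
    have : (Fintype.card κ : ℝ) + 1 < Fintype.card ι := mod_cast hcard
    exact pow_pos (by linarith) 2
  have hlim : Filter.Tendsto (fun ε : ℝ => ε * ((Fintype.card ι : ℝ) * Fintype.card κ))
      (nhdsWithin 0 (Set.Ioi 0)) (nhds 0) := by
    have : Continuous fun ε : ℝ => ε * ((Fintype.card ι : ℝ) * Fintype.card κ) := by fun_prop
    simpa only [zero_mul] using (this.tendsto 0).mono_left nhdsWithin_le_nhds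
  have hle := ge_of_tendsto hlim <| Filter.eventually_of_mem self_mem_nhdsWithin fun ε hε =>
    hX.sq_mul_measureReal_det_gram_eq_zero_le hε hcard.le
  have hzero : P.real {ω | ((X ω)ᵀ * X ω).det = 0} = 0 :=
    le_antisymm (nonpos_of_mul_nonpos_right hle hd) measureReal_nonneg
  simpa only [ae_iff, not_not] using (measureReal_eq_zero_iff).1 hzero

theorem integrable_and_integral_directionalLoss_ridgeEfronMorris_zero_le
    (hX : IsGaussianMatrix X M P) (hcard : Fintype.card κ + 1 < Fintype.card ι) {c : ℝ}
    (hc : 0 ≤ c) (hc_le : c ≤ 2 * ((Fintype.card ι : ℝ) - Fintype.card κ - 1)) (v : κ → ℝ) :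
    Integrable (fun ω => directionalLoss M (ridgeEfronMorris c 0 (X ω)) v) P ∧
      ∫ ω, directionalLoss M (ridgeEfronMorris c 0 (X ω)) v ∂P ≤
        Fintype.card ι * (v ⬝ᵥ v) -
          c * (2 * ((Fintype.card ι : ℝ) - Fintype.card κ - 1) - c) *
            (v ⬝ᵥ ridgeInv (Fintype.card ι) M *ᵥ v) := by
  let ε : ℕ → ℝ := fun k => 1 / ((k : ℝ) + 1)
  have hε : ∀ k, 0 < ε k := fun k => Nat.one_div_pos_of_nat
  have hε_lim : Filter.Tendsto ε Filter.atTop (nhds 0) := tendsto_one_div_add_atTop_nhds_zero_nat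
  have hι : (0 : ℝ) < Fintype.card ι := mod_cast (Nat.zero_le _).trans_lt hcard
  have hM_lim : Filter.Tendsto (fun k => ridgeInv (Fintype.card ι + ε k) M) Filter.atTop
      (nhds (ridgeInv (Fintype.card ι) M)) := by
    simpa using tendsto_ridgeInv (hε_lim.const_add (Fintype.card ι : ℝ)) tendsto_const_nhds
      (by simpa using (posDef_gram_add_smul_one hι M).det_pos.ne')
  refine integrable_and_integral_le_of_tendsto_of_le
    (F := fun k ω => directionalLoss M (ridgeEfronMorris c (ε k) (X ω)) v)
    (b := fun k => Fintype.card ι * (v ⬝ᵥ v) -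
      c * (2 * ((Fintype.card ι : ℝ) - Fintype.card κ - 1) - c) *
        (v ⬝ᵥ ridgeInv (Fintype.card ι + ε k) M *ᵥ v))
    (fun k ω => directionalLoss_nonneg M _ v)
    (fun k => hX.integrable_directionalLoss_ridgeEfronMorris (hε k) c v) ?_
    (fun k => (hX.integral_directionalLoss_ridgeEfronMorris_le (hε k) hc v).trans ?_) ?_
  · filter_upwards [hX.ae_det_gram_ne_zero hcard] with ω hω
    have hR := tendsto_ridgeInv hε_lim (tendsto_const_nhds (x := X ω)) (by simpa using hω)
    have hcont : Continuous fun R : Matrix κ κ ℝ =>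
        ((X ω * (1 - c • R) - M) *ᵥ v) ⬝ᵥ ((X ω * (1 - c • R) - M) *ᵥ v) := by fun_prop
    exact (hcont.tendsto _).comp hR
  · exact sub_le_sub_left (mul_le_mul_of_nonneg_left
      (hX.dotProduct_ridgeInv_mulVec_le_integral (hε k) v) (mul_nonneg hc (by linarith))) _
  · have hcont : Continuous fun R : Matrix κ κ ℝ => v ⬝ᵥ R *ᵥ v := by fun_prop
    exact (((hcont.tendsto _).comp hM_lim).const_mul _).const_sub _

end IsGaussianMatrix

end ZeroRidge

section LinearOracle

variable {Ω : Type*} [MeasurableSpace Ω] {P : Measure Ω} {ι κ : Type*} [Fintype ι] [Fintype κ]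
  {X : Ω → Matrix ι κ ℝ} {M : Matrix ι κ ℝ}

namespace IsGaussianMatrix

theorem integral_directionalLoss_mul (hX : IsGaussianMatrix X M P) (C : Matrix κ κ ℝ)
    (v : κ → ℝ) : ∫ ω, directionalLoss M (X ω * C) v ∂P =
      Fintype.card ι * ((C *ᵥ v) ⬝ᵥ (C *ᵥ v)) + directionalLoss M (M * C) v := by
  simp only [directionalLoss, sub_mulVec, ← mulVec_mulVec]
  exact hX.integral_mulVec_sub_dotProduct_self (C *ᵥ v) (M *ᵥ v)

theorem integral_directionalLoss_mul_one_sub_smul_ridgeInv [Nonempty ι] [DecidableEq κ]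
    (hX : IsGaussianMatrix X M P) (v : κ → ℝ) :
    ∫ ω, directionalLoss M
      (X ω * (1 - (Fintype.card ι : ℝ) • ridgeInv (Fintype.card ι) M)) v ∂P =
      Fintype.card ι * (v ⬝ᵥ v) -
        (Fintype.card ι : ℝ) ^ 2 * (v ⬝ᵥ ridgeInv (Fintype.card ι) M *ᵥ v) := by
  have hι : (0 : ℝ) < Fintype.card ι := mod_cast Fintype.card_pos
  set N : ℝ := (Fintype.card ι : ℝ)
  set R := ridgeInv N M with hR
  have hRR : (R *ᵥ v) ⬝ᵥ (R *ᵥ v) = v ⬝ᵥ (R * R) *ᵥ v := by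
    rw [← dotProduct_transpose_mul_mulVec, hR, transpose_ridgeInv]
  have hbias : directionalLoss M (M * (1 - N • R)) v =
      N ^ 2 * (v ⬝ᵥ R *ᵥ v - N * (v ⬝ᵥ (R * R) *ᵥ v)) := by
    have hgram := congrArg (fun A => v ⬝ᵥ A *ᵥ v) (gram_mul_ridgeInv_eq hι M)
    simp only [dotProduct_transpose_mul_mulVec, sub_mulVec, smul_mulVec, dotProduct_sub,
      dotProduct_smul, smul_eq_mul] at hgram
    rw [← hgram, directionalLoss]
    simp only [Matrix.mul_sub, Matrix.mul_one, Matrix.mul_smul, sub_sub_cancel_left, neg_mulVec,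
      smul_mulVec, neg_dotProduct, dotProduct_neg, smul_dotProduct, dotProduct_smul, smul_eq_mul]
    ring
  rw [hX.integral_directionalLoss_mul, hbias]
  simp only [sub_mulVec, one_mulVec, smul_mulVec, sub_dotProduct, dotProduct_sub, smul_dotProduct,
    dotProduct_smul, smul_eq_mul, hRR, dotProduct_comm (R *ᵥ v) v]
  ring

end IsGaussianMatrix

end LinearOracle

section MatrixRisk

variable {Ω : Type*} [MeasurableSpace Ω] {P : Measure Ω} {n p : ℕ}
  {X : Ω → Matrix (Fin n) (Fin p) ℝ} {M : Matrix (Fin n) (Fin p) ℝ}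
  {δ : Matrix (Fin n) (Fin p) ℝ → Matrix (Fin n) (Fin p) ℝ}

theorem dotProduct_matrixQuadraticLoss_mulVec (M Mhat : Matrix (Fin n) (Fin p) ℝ)
    (v : Fin p → ℝ) : v ⬝ᵥ matrixQuadraticLoss M Mhat *ᵥ v = directionalLoss M Mhat v :=
  dotProduct_transpose_mul_mulVec _ _ v v

theorem matrixQuadraticLoss_apply_comm (M Mhat : Matrix (Fin n) (Fin p) ℝ) (i j : Fin p) :
    matrixQuadraticLoss M Mhat i j = matrixQuadraticLoss M Mhat j i :=
  ((isHermitian_conjTranspose_mul_self (Mhat - M)).apply i j).symm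

theorem two_mul_matrixQuadraticLoss_apply (M Mhat : Matrix (Fin n) (Fin p) ℝ) (i j : Fin p) :
    2 * matrixQuadraticLoss M Mhat i j =
      directionalLoss M Mhat (Pi.single i 1 + Pi.single j 1) -
        directionalLoss M Mhat (Pi.single i 1) - directionalLoss M Mhat (Pi.single j 1) := by
  simp only [← dotProduct_matrixQuadraticLoss_mulVec, mulVec_add, add_dotProduct, dotProduct_add,
    mulVec_single_one, single_one_dotProduct, Matrix.col_apply]
  rw [matrixQuadraticLoss_apply_comm M Mhat j i]
  ring

theorem hasFiniteMatrixRisk_of_integrable_directionalLoss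
    (h : ∀ v, Integrable (fun ω => directionalLoss M (δ (X ω)) v) P) :
    HasFiniteMatrixRisk P X M δ := fun i j => by
  refine ((((h (Pi.single i 1 + Pi.single j 1)).sub (h (Pi.single i 1))).sub
    (h (Pi.single j 1))).const_mul (1 / 2)).congr (ae_of_all _ fun ω => ?_)
  have := two_mul_matrixQuadraticLoss_apply M (δ (X ω)) i j
  simp only [Pi.sub_apply]
  linarith

theorem isHermitian_matrixQuadraticRisk : (matrixQuadraticRisk P X M δ).IsHermitian :=
  Matrix.IsHermitian.ext fun i j => integral_congr_ae <| ae_of_all _ fun ω =>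
    matrixQuadraticLoss_apply_comm M (δ (X ω)) j i

theorem HasFiniteMatrixRisk.dotProduct_matrixQuadraticRisk_mulVec
    (h : HasFiniteMatrixRisk P X M δ) (v : Fin p → ℝ) :
    v ⬝ᵥ matrixQuadraticRisk P X M δ *ᵥ v = ∫ ω, directionalLoss M (δ (X ω)) v ∂P := by
  simp only [← dotProduct_matrixQuadraticLoss_mulVec]
  exact (integral_dotProduct_mulVec h v v).symm

theorem ridgeEfronMorris_zero (x : Matrix (Fin n) (Fin p) ℝ) :
    ridgeEfronMorris ((n : ℝ) - p - 1) 0 x = efronMorris x := by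
  rw [ridgeEfronMorris, ridgeInv, zero_smul, add_zero, efronMorris]

theorem oracleCoeff_eq [NeZero n] (M : Matrix (Fin n) (Fin p) ℝ) :
    oracleCoeff M = 1 - (n : ℝ) • ridgeInv n M :=
  ridgeInv_mul_gram (Nat.cast_pos.2 (NeZero.pos n)) M

theorem isHermitian_smul_one_sub_smul_ridgeInv (a b ε : ℝ) (M : Matrix (Fin n) (Fin p) ℝ) :
    (a • (1 : Matrix (Fin p) (Fin p) ℝ) - b • ridgeInv ε M).IsHermitian := by
  simp only [IsHermitian, conjTranspose_eq_transpose_of_trivial, transpose_sub, transpose_smul,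
    transpose_one, transpose_ridgeInv]

theorem dotProduct_smul_one_sub_smul_mulVec (a b : ℝ) (A : Matrix (Fin p) (Fin p) ℝ)
    (v : Fin p → ℝ) :
    v ⬝ᵥ (a • (1 : Matrix (Fin p) (Fin p) ℝ) - b • A) *ᵥ v = a * (v ⬝ᵥ v) - b * (v ⬝ᵥ A *ᵥ v) := by
  simp only [sub_mulVec, smul_mulVec, one_mulVec, dotProduct_sub, dotProduct_smul, smul_eq_mul]

namespace IsGaussianMatrix

theorem hasFiniteMatrixRisk_linearEstimator (hX : IsGaussianMatrix X M P)
    (C : Matrix (Fin p) (Fin p) ℝ) : HasFiniteMatrixRisk P X M (linearEstimator C) :=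
  integrable_transpose_mul_apply (hX.memLp_mul_sub_apply C) (hX.memLp_mul_sub_apply C)

theorem matrixQuadraticRisk_linearEstimator_oracleCoeff [NeZero n]
    (hX : IsGaussianMatrix X M P) :
    matrixQuadraticRisk P X M (linearEstimator (oracleCoeff M)) =
      (n : ℝ) • 1 - (n : ℝ) ^ 2 • ridgeInv n M := by
  have hform : ∀ v, v ⬝ᵥ matrixQuadraticRisk P X M (linearEstimator (oracleCoeff M)) *ᵥ v =
      v ⬝ᵥ ((n : ℝ) • 1 - (n : ℝ) ^ 2 • ridgeInv n M) *ᵥ v := fun v => by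
    have horacle := hX.integral_directionalLoss_mul_one_sub_smul_ridgeInv v
    rw [Fintype.card_fin, ← oracleCoeff_eq] at horacle
    rw [(hX.hasFiniteMatrixRisk_linearEstimator _).dotProduct_matrixQuadraticRisk_mulVec,
      dotProduct_smul_one_sub_smul_mulVec]
    exact horacle
  have hherm := isHermitian_smul_one_sub_smul_ridgeInv n (n ^ 2) n M
  exact le_antisymm
    (le_of_dotProduct_mulVec_le isHermitian_matrixQuadraticRisk hherm fun v => (hform v).le)
    (le_of_dotProduct_mulVec_le hherm isHermitian_matrixQuadraticRisk fun v => (hform v).ge)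

theorem integrable_and_integral_directionalLoss_efronMorris_le (hX : IsGaussianMatrix X M P)
    (hnp : p + 1 < n) (v : Fin p → ℝ) :
    Integrable (fun ω => directionalLoss M (efronMorris (X ω)) v) P ∧
      ∫ ω, directionalLoss M (efronMorris (X ω)) v ∂P ≤
        n * (v ⬝ᵥ v) - ((n : ℝ) - p - 1) ^ 2 * (v ⬝ᵥ ridgeInv n M *ᵥ v) := by
  have hd : (0 : ℝ) ≤ (n : ℝ) - p - 1 := by
    have : (p : ℝ) + 1 < n := mod_cast hnp
    linarith
  have hrisk := hX.integrable_and_integral_directionalLoss_ridgeEfronMorris_zero_le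
    (by simpa only [Fintype.card_fin] using hnp) hd
    (by simp only [Fintype.card_fin]; linarith) v
  simp only [Fintype.card_fin, ridgeEfronMorris_zero] at hrisk
  refine ⟨hrisk.1, hrisk.2.trans_eq ?_⟩
  ring

theorem hasFiniteMatrixRisk_efronMorris (hX : IsGaussianMatrix X M P) (hnp : p + 1 < n) :
    HasFiniteMatrixRisk P X M efronMorris :=
  hasFiniteMatrixRisk_of_integrable_directionalLoss fun v =>
    (hX.integrable_and_integral_directionalLoss_efronMorris_le hnp v).1

theorem matrixQuadraticRisk_efronMorris_le (hX : IsGaussianMatrix X M P) (hnp : p + 1 < n) :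
    matrixQuadraticRisk P X M efronMorris ≤
      (n : ℝ) • 1 - ((n : ℝ) - p - 1) ^ 2 • ridgeInv n M := by
  refine le_of_dotProduct_mulVec_le isHermitian_matrixQuadraticRisk
    (isHermitian_smul_one_sub_smul_ridgeInv _ _ _ M) fun v => ?_
  rw [(hX.hasFiniteMatrixRisk_efronMorris hnp).dotProduct_matrixQuadraticRisk_mulVec,
    dotProduct_smul_one_sub_smul_mulVec]
  exact (hX.integrable_and_integral_directionalLoss_efronMorris_le hnp v).2

end IsGaussianMatrix

end MatrixRisk

theorem smul_one_sub_sq_smul_ridgeInv_le {ι κ : Type*} [Fintype ι] [Fintype κ] [DecidableEq κ]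
    {a : ℝ} (ha : 0 < a) {b : ℝ} (hb : 0 ≤ b) (M : Matrix ι κ ℝ) :
    a • 1 - (a - b) ^ 2 • ridgeInv a M ≤
      a • 1 - a ^ 2 • ridgeInv a M + (2 * b) • (1 : Matrix κ κ ℝ) := by
  have hdiff : a • 1 - a ^ 2 • ridgeInv a M + (2 * b) • (1 : Matrix κ κ ℝ) -
      (a • 1 - (a - b) ^ 2 • ridgeInv a M) =
        (2 * b) • (1 - a • ridgeInv a M) + b ^ 2 • ridgeInv a M := by
    module
  rw [← sub_nonneg, hdiff]
  exact add_nonneg (smul_nonneg (by positivity) (sub_nonneg.2 (smul_ridgeInv_le_one ha M)))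
    (smul_nonneg (sq_nonneg b) (posDef_ridgeInv ha M).posSemidef.nonneg)

theorem mainTheorem3 {Ω : Type*} [MeasurableSpace Ω] (P : Measure Ω) [IsProbabilityMeasure P]
    (n p : ℕ) (hnp : p + 1 < n)
    (M : Matrix (Fin n) (Fin p) ℝ)
    (X : Ω → Matrix (Fin n) (Fin p) ℝ)
    (hlaw : ∀ i j, HasLaw (fun ω => X ω i j) (gaussianReal (M i j) 1) P)
    (hindep : iIndepFun (fun (ij : Fin n × Fin p) ω => X ω ij.1 ij.2) P) :
    HasFiniteMatrixRisk P X M efronMorris ∧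
    HasFiniteMatrixRisk P X M (linearEstimator (oracleCoeff M)) ∧
    matrixQuadraticRisk P X M efronMorris ≤
      matrixQuadraticRisk P X M (linearEstimator (oracleCoeff M)) +
        (2 * ((p : ℝ) + 1)) • (1 : Matrix (Fin p) (Fin p) ℝ) := by
  have hX : IsGaussianMatrix X M P := ⟨hlaw, hindep⟩
  have hn : NeZero n := ⟨by lia⟩
  refine ⟨hX.hasFiniteMatrixRisk_efronMorris hnp, hX.hasFiniteMatrixRisk_linearEstimator _, ?_⟩
  calc matrixQuadraticRisk P X M efronMorris
      ≤ (n : ℝ) • 1 - ((n : ℝ) - (p + 1)) ^ 2 • ridgeInv n M := by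
        rw [← sub_sub]
        exact hX.matrixQuadraticRisk_efronMorris_le hnp
    _ ≤ (n : ℝ) • 1 - (n : ℝ) ^ 2 • ridgeInv n M + (2 * ((p : ℝ) + 1)) • 1 :=
        smul_one_sub_sq_smul_ridgeInv_le (Nat.cast_pos.2 (NeZero.pos n)) (by positivity) M
    _ = matrixQuadraticRisk P X M (linearEstimator (oracleCoeff M)) +
          (2 * ((p : ℝ) + 1)) • 1 := by
        rw [hX.matrixQuadraticRisk_linearEstimator_oracleCoeff]
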